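/- Let $\nu$ be a finite Borel measure on a Hausdorff space $\Omega$ and let $\Theta$ be a closed linear subspace of the real Hilbert space $L_2(\nu)$ that contains the constant function $1$. For $\lambda\in L_2(\nu)$ with $\lambda\ge 0$ $\nu$-a.e., let $P_\lambda^{(n)}$ be the joint law of $n$ independent realizations $\kappa_1,\dots,\kappa_n$ of the Poisson process on $\Omega$ with mean measure $\lambda\,d\nu$. Let $\Theta_0,\Theta_1\subset\Theta$ be sets of $\nu$-a.e. nonnegative functions, bounded in $L_2(\nu)$. A test $K_n$ is a measurable function of $(\kappa_1,\dots,\kappa_n)$ with values in $[0,1]$; put $$\alpha(K_n)=\sup_{\lambda\in\Theta_0}E_\lambda K_n,\qquad \beta(K_n)=\sup_{\lambda\in\Theta_1}E_\lambda(1-K_n)$$ (suprema over the empty set being $0$), where $E_\lambda$ is the expectation under $P_\lambda^{(n)}$. The sets $\Theta_0$ and $\Theta_1$ are called distinguishable if for every $0<\alpha<1$ there are tests $K_n$, $n\ge 1$, with $\alpha(K_n)<\alpha$ for all $n$ and $\beta(K_n)\to 0$ as $n\to\infty$; they are called indistinguishable if $\alpha(K_n)+\beta(K_n)\ge 1$ for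 every $n\ge 1$ and every test $K_n$. For a finite-dimensional subspace $\Gamma\subset L_2(\nu)$ let $\Pi_\Gamma$ be the orthogonal projection onto $\Gamma$, and write $\overline{\Psi}$ for the closure of $\Psi\subset L_2(\nu)$ in $L_2(\nu)$. Then $\Theta_0$ and $\Theta_1$ are distinguishable if and only if there is a finite-dimensional subspace $\Gamma\subset\Theta$ such that $$\overline{\Pi_\Gamma\overline{\Theta}_0}\cap\overline{\Pi_\Gamma\overline{\Theta}_1}=\emptyset ,$$ and if there is no such $\Gamma$, they are indistinguishable. -/

import Mathlib

open MeasureTheory Filter Topology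
open scoped ENNReal

namespace PoissonTesting

section Law

variable {Ω : Type*} [MeasurableSpace Ω]

/-- The point configuration with atoms `x 0, …, x (k - 1)` (with multiplicity), as a counting
measure: `δ_{x 0} + ⋯ + δ_{x (k - 1)}`. -/
noncomputable def atoms {k : ℕ} (x : Fin k → Ω) : Measure Ω :=
  ∑ i, Measure.dirac (x i)

theorem measurable_atoms (k : ℕ) : Measurable (atoms : (Fin k → Ω) → Measure Ω) := by
  refine Measure.measurable_of_measurable_coe _ fun s hs => ?_
  simp only [atoms, Measure.finsetSum_apply]
  refine Finset.measurable_sum _ fun i _ => ?_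
  exact ((Measure.measurable_coe hs).comp Measure.measurable_dirac).comp (measurable_pi_apply i)

/-- The law of the Poisson random measure (Poisson process) with finite mean measure `μ`, as a
probability measure on the space of measures on `Ω` with the σ-field generated by the evaluations
`κ ↦ κ B`. The number of atoms is Poisson with parameter `μ Ω`; given that it is `k`, the atoms
are `k` independent points with distribution `μ / μ Ω`. The weight of `k` atoms is therefore
`exp (-μ Ω) (μ Ω) ^ k / k!` times the image of `(μ / μ Ω) ^ ⊗ k`, which is
`exp (-μ Ω) / k!` times the image of `μ ^ ⊗ k`. -/
noncomputable def poissonLaw (μ : Measure Ω) : Measure (Measure Ω) :=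
  Measure.sum fun k : ℕ =>
    ENNReal.ofReal (Real.exp (-(μ Set.univ).toReal) / (k.factorial : ℝ)) •
      (Measure.pi fun _ : Fin k => μ).map atoms

instance isProbabilityMeasure_poissonLaw (μ : Measure Ω) [IsFiniteMeasure μ] :
    IsProbabilityMeasure (poissonLaw μ) := by
  constructor
  set m : ℝ := (μ Set.univ).toReal with hm
  have hm0 : 0 ≤ m := ENNReal.toReal_nonneg
  have hμ : μ Set.univ = ENNReal.ofReal m := (ENNReal.ofReal_toReal (measure_ne_top _ _)).symm
  have key : ∀ k : ℕ,
      (ENNReal.ofReal (Real.exp (-m) / (k.factorial : ℝ)) •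
        (Measure.pi fun _ : Fin k => μ).map atoms) Set.univ
        = ENNReal.ofReal (Real.exp (-m) * (m ^ k / (k.factorial : ℝ))) := by
    intro k
    rw [Measure.smul_apply, Measure.map_apply (measurable_atoms k) MeasurableSet.univ,
      Set.preimage_univ, Measure.pi_univ, Finset.prod_const, Finset.card_univ, Fintype.card_fin,
      hμ, ← ENNReal.ofReal_pow hm0, smul_eq_mul, ← ENNReal.ofReal_mul (by positivity)]
    congr 1
    ring
  have hs : HasSum (fun k : ℕ => Real.exp (-m) * (m ^ k / (k.factorial : ℝ))) 1 := by
    have h := (NormedSpace.expSeries_div_hasSum_exp (𝔸 := ℝ) m).mul_left (Real.exp (-m))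
    rwa [← Real.exp_eq_exp_ℝ, ← Real.exp_add, neg_add_cancel, Real.exp_zero] at h
  rw [poissonLaw, Measure.sum_apply _ MeasurableSet.univ]
  simp only [← hm]
  rw [tsum_congr key, ← ENNReal.ofReal_tsum_of_nonneg (fun k => by positivity) hs.summable,
    hs.tsum_eq, ENNReal.ofReal_one]

end Law

section Tests

variable {Ω : Type*} [MeasurableSpace Ω]

/-- A (possibly randomized) test based on `n` observed realizations `κ 0, …, κ (n - 1)`:
`K κ` is the probability of rejecting the hypothesis. -/
structure Test (Ω : Type*) [MeasurableSpace Ω] (n : ℕ) where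
  /-- The probability of rejection. -/
  toFun : (Fin n → Measure Ω) → ℝ
  measurable : Measurable toFun
  nonneg : ∀ κ, 0 ≤ toFun κ
  le_one : ∀ κ, toFun κ ≤ 1

variable {ν : Measure Ω}

/-- The mean measure `f dν` with intensity function `f` (used for `f ≥ 0`). -/
noncomputable def meanMeasure (f : Lp ℝ 2 ν) : Measure Ω :=
  ν.withDensity fun t => ENNReal.ofReal (f t)

/-- The joint law of `n` independent realizations of the Poisson process with intensity `f`. -/
noncomputable def sampleLaw (n : ℕ) (f : Lp ℝ 2 ν) : Measure (Fin n → Measure Ω) :=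
  Measure.pi fun _ => poissonLaw (meanMeasure f)

instance isProbabilityMeasure_sampleLaw [IsFiniteMeasure ν] (n : ℕ) (f : Lp ℝ 2 ν) :
    IsProbabilityMeasure (sampleLaw n f) := by
  have hf : Integrable (fun t => f t) ν := (Lp.memLp f).integrable (by norm_num)
  have : IsFiniteMeasure (meanMeasure f) := isFiniteMeasure_withDensity_ofReal hf.2
  unfold sampleLaw
  infer_instance

/-- The type I error `sup_{f ∈ Θ₀} E_f K` (zero if `Θ₀` is empty). -/
noncomputable def typeIError {n : ℕ} (Θ₀ : Set (Lp ℝ 2 ν)) (K : Test Ω n) : ℝ :=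
  ⨆ f : Θ₀, ∫ κ, K.toFun κ ∂(sampleLaw n (f : Lp ℝ 2 ν))

/-- The type II error `sup_{f ∈ Θ₁} E_f (1 - K)` (zero if `Θ₁` is empty). -/
noncomputable def typeIIError {n : ℕ} (Θ₁ : Set (Lp ℝ 2 ν)) (K : Test Ω n) : ℝ :=
  ⨆ f : Θ₁, ∫ κ, (1 - K.toFun κ) ∂(sampleLaw n (f : Lp ℝ 2 ν))

/-- Distinguishability: for each level `0 < a < 1` there are tests `K n`, `n ≥ 1`, with type I
errors less than `a` and with type II errors tending to zero. -/
def Distinguishable (Θ₀ Θ₁ : Set (Lp ℝ 2 ν)) : Prop :=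
  ∀ a : ℝ, 0 < a → a < 1 → ∃ K : (n : ℕ) → Test Ω n,
    (∀ n, 1 ≤ n → typeIError Θ₀ (K n) < a) ∧
      Tendsto (fun n => typeIIError Θ₁ (K n)) atTop (𝓝 0)

/-- Indistinguishability: for each sample size, no test has a sum of errors less than one. -/
def Indistinguishable (Θ₀ Θ₁ : Set (Lp ℝ 2 ν)) : Prop :=
  ∀ n : ℕ, 1 ≤ n → ∀ K : Test Ω n, 1 ≤ typeIError Θ₀ K + typeIIError Θ₁ K

/-- Some finite-dimensional subspace `Γ` of `Θ` has the property that the closures of the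
orthogonal projections to `Γ` of the `L²`-closures of `Θ₀` and `Θ₁` are disjoint. -/
def FiniteDimSeparated (Θ : Submodule ℝ (Lp ℝ 2 ν)) (Θ₀ Θ₁ : Set (Lp ℝ 2 ν)) : Prop :=
  ∃ (Γ : Submodule ℝ (Lp ℝ 2 ν)) (_ : FiniteDimensional ℝ Γ), Γ ≤ Θ ∧
    Disjoint (closure (Γ.starProjection '' closure Θ₀)) (closure (Γ.starProjection '' closure Θ₁))

end Tests

end PoissonTesting

namespace PoissonTesting

section Separation

variable {Ω : Type*} [MeasurableSpace Ω] {ν : Measure Ω}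

/-- Finitely many set integrals separate `Θ₀` from `Θ₁` uniformly. -/
def SetwiseSeparated (Θ₀ Θ₁ : Set (Lp ℝ 2 ν)) : Prop :=
  ∃ (F : Finset {A : Set Ω // MeasurableSet A}) (δ : ℝ), 0 < δ ∧
    ∀ f ∈ Θ₀, ∀ g ∈ Θ₁, ∃ A ∈ F, δ ≤ |(∫ t in A.1, f t ∂ν) - ∫ t in A.1, g t ∂ν|

theorem exists_net_of_not_setwiseSeparated {Θ₀ Θ₁ : Set (Lp ℝ 2 ν)}
    (h : ¬ SetwiseSeparated Θ₀ Θ₁) :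
    ∃ f g : Finset {A : Set Ω // MeasurableSet A} × ℕ → Lp ℝ 2 ν,
      (∀ i, f i ∈ Θ₀) ∧ (∀ i, g i ∈ Θ₁) ∧ ∀ A : Set Ω, MeasurableSet A →
        Tendsto (fun i => (∫ t in A, f i t ∂ν) - ∫ t in A, g i t ∂ν) atTop (𝓝 0) := by
  have key : ∀ i : Finset {A : Set Ω // MeasurableSet A} × ℕ, ∃ f ∈ Θ₀, ∃ g ∈ Θ₁, ∀ A ∈ i.1,
      |(∫ t in A.1, f t ∂ν) - ∫ t in A.1, g t ∂ν| < 1 / ((i.2 : ℝ) + 1) := by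
    intro i
    by_contra! hc
    exact h ⟨i.1, 1 / ((i.2 : ℝ) + 1), by positivity, hc⟩
  choose f hf g hg hfg using key
  refine ⟨f, g, hf, hg, fun A hA => ?_⟩
  have ht : Tendsto (fun i : Finset {A : Set Ω // MeasurableSet A} × ℕ => 1 / ((i.2 : ℝ) + 1))
      atTop (𝓝 0) := by
    refine tendsto_one_div_add_atTop_nhds_zero_nat.comp ?_
    rw [← prod_atTop_atTop_eq]
    exact tendsto_snd
  refine squeeze_zero_norm' ?_ ht
  filter_upwards [eventually_ge_atTop (({⟨A, hA⟩} : Finset {A : Set Ω // MeasurableSet A}), 0)]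
    with i hi
  exact (hfg i ⟨A, hA⟩ (hi.1 (Finset.mem_singleton_self _))).le

theorem tendsto_inner_of_tendsto_setIntegral {ι : Type*} {l : Filter ι} {u : ι → Lp ℝ 2 ν} {C : ℝ}
    (hC : ∀ i, ‖u i‖ ≤ C)
    (h : ∀ A : Set Ω, MeasurableSet A → Tendsto (fun i => ∫ t in A, u i t ∂ν) l (𝓝 0))
    (φ : Lp ℝ 2 ν) : Tendsto (fun i => inner ℝ φ (u i)) l (𝓝 0) := by
  refine Lp.induction (p := 2) (by norm_num)
    (fun φ : Lp ℝ 2 ν => Tendsto (fun i => inner ℝ φ (u i)) l (𝓝 0)) ?_ ?_ ?_ φ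
  · intro c A hA hA'
    have : (fun i => inner ℝ ((Lp.simpleFunc.indicatorConst 2 hA hA'.ne c : Lp ℝ 2 ν)) (u i))
        = fun i => (∫ t in A, u i t ∂ν) * c := by
      funext i
      rw [Lp.simpleFunc.coe_indicatorConst,
        L2.inner_indicatorConstLp_eq_inner_setIntegral ℝ hA hA'.ne]
      rfl
    rw [this]
    simpa using (h A hA).mul_const c
  · intro f g hf hg _ h₁ h₂
    simpa [inner_add_left] using h₁.add h₂
  · refine isClosed_of_closure_subset fun φ hφ => ?_
    rw [Set.mem_ofPred_eq, Metric.tendsto_nhds]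
    intro ε hε
    have hC' : 0 < |C| + 1 := by positivity
    obtain ⟨ψ, hψ, hd⟩ := Metric.mem_closure_iff.1 hφ (ε / 2 / (|C| + 1)) (by positivity)
    filter_upwards [Metric.tendsto_nhds.1 hψ (ε / 2) (by positivity)] with i hi
    rw [Real.dist_eq, sub_zero] at hi ⊢
    have h₁ : |inner ℝ (φ - ψ) (u i)| ≤ ε / 2 := by
      refine (abs_real_inner_le_norm _ _).trans ?_
      rw [dist_eq_norm, lt_div_iff₀ hC'] at hd
      have := hC i
      have := le_abs_self C
      nlinarith [norm_nonneg (φ - ψ)]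
    have h₂ : inner ℝ φ (u i) = inner ℝ (φ - ψ) (u i) + inner ℝ ψ (u i) := by
      rw [inner_sub_left]; ring
    rw [h₂]
    exact (abs_add_le _ _).trans_lt (by linarith)

theorem tendsto_starProjection_of_tendsto_inner {E : Type*} [NormedAddCommGroup E]
    [InnerProductSpace ℝ E] {ι : Type*} {l : Filter ι} {u : ι → E}
    (h : ∀ φ, Tendsto (fun i => inner ℝ φ (u i)) l (𝓝 0))
    (Γ : Submodule ℝ E) [FiniteDimensional ℝ Γ] :
    Tendsto (fun i => Γ.starProjection (u i)) l (𝓝 0) := by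
  have hb : ∀ x, Γ.starProjection x
      = ∑ j, inner ℝ (stdOrthonormalBasis ℝ Γ j : E) x • (stdOrthonormalBasis ℝ Γ j : E) := by
    intro x
    have := (stdOrthonormalBasis ℝ Γ).orthogonalProjectionOnto_apply_eq_sum x
    rw [Submodule.starProjection_apply, this]
    simp
  simp only [hb]
  rw [show (0 : E) = ∑ j, (0 : ℝ) • (stdOrthonormalBasis ℝ Γ j : E) by simp]
  exact tendsto_finsetSum _ fun j _ => (h _).smul_const _

theorem isCompact_closure_starProjection_image {E : Type*} [NormedAddCommGroup E]
    [InnerProductSpace ℝ E] (Γ : Submodule ℝ E) [FiniteDimensional ℝ Γ] {s : Set E}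
    (hs : Bornology.IsBounded s) : IsCompact (closure (Γ.starProjection '' s)) := by
  obtain ⟨R, hR⟩ := hs.exists_norm_le
  have hK : IsCompact ((↑) '' Metric.closedBall (0 : Γ) R : Set E) :=
    (isCompact_closedBall _ _).image continuous_subtype_val
  refine hK.of_isClosed_subset isClosed_closure (closure_minimal ?_ hK.isClosed)
  rintro _ ⟨x, hx, rfl⟩
  refine ⟨⟨_, Γ.starProjection_apply_mem x⟩, ?_, rfl⟩
  rw [mem_closedBall_zero_iff]
  exact (Γ.norm_starProjection_apply_le x).trans (hR x hx)

theorem FiniteDimSeparated.setwiseSeparated {Θ : Submodule ℝ (Lp ℝ 2 ν)} [IsFiniteMeasure ν]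
    {Θ₀ Θ₁ : Set (Lp ℝ 2 ν)} (h : FiniteDimSeparated Θ Θ₀ Θ₁)
    (hbdd₀ : Bornology.IsBounded Θ₀) (hbdd₁ : Bornology.IsBounded Θ₁) :
    SetwiseSeparated Θ₀ Θ₁ := by
  obtain ⟨Γ, _, _, hd⟩ := h
  by_contra hc
  obtain ⟨f, g, hf, hg, hfg⟩ := exists_net_of_not_setwiseSeparated hc
  obtain ⟨R₀, hR₀⟩ := hbdd₀.exists_norm_le
  obtain ⟨R₁, hR₁⟩ := hbdd₁.exists_norm_le
  have hint : ∀ (A : Set Ω) (u : Lp ℝ 2 ν), IntegrableOn u A ν := fun A u =>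
    ((Lp.memLp u).integrable (by norm_num)).integrableOn
  have hsub : ∀ A : Set Ω, MeasurableSet A →
      Tendsto (fun i => ∫ t in A, (f i - g i : Lp ℝ 2 ν) t ∂ν) atTop (𝓝 0) := by
    intro A hA
    refine (hfg A hA).congr fun i => ?_
    rw [← integral_sub (hint A _) (hint A _)]
    exact integral_congr_ae (ae_restrict_of_ae (Lp.coeFn_sub (f i) (g i)).symm)
  have hT := tendsto_starProjection_of_tendsto_inner
    (tendsto_inner_of_tendsto_setIntegral (C := R₀ + R₁)
      (fun i => (norm_sub_le _ _).trans (add_le_add (hR₀ _ (hf i)) (hR₁ _ (hg i)))) hsub) Γ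
  obtain ⟨δ, hδ, hdis⟩ := hd.exists_thickenings
    (isCompact_closure_starProjection_image Γ hbdd₀.closure) isClosed_closure
  obtain ⟨i, hi⟩ := (Metric.tendsto_nhds.1 hT δ hδ).exists
  rw [map_sub, dist_zero_right, ← dist_eq_norm] at hi
  refine Set.disjoint_left.1 hdis (?_ : Γ.starProjection (f i) ∈ _) ?_
  · exact Metric.self_subset_thickening hδ _ (subset_closure ⟨_, subset_closure (hf i), rfl⟩)
  · exact Metric.mem_thickening_iff.2
      ⟨_, subset_closure ⟨_, subset_closure (hg i), rfl⟩, hi⟩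

theorem SetwiseSeparated.finiteDimSeparated [IsFiniteMeasure ν] {Θ : Submodule ℝ (Lp ℝ 2 ν)}
    (hΘ : IsClosed (Θ : Set (Lp ℝ 2 ν))) {Θ₀ Θ₁ : Set (Lp ℝ 2 ν)}
    (hΘ₀ : Θ₀ ⊆ Θ) (hΘ₁ : Θ₁ ⊆ Θ) (h : SetwiseSeparated Θ₀ Θ₁) :
    FiniteDimSeparated Θ Θ₀ Θ₁ := by
  obtain ⟨F, δ, hδ, hF⟩ := h
  have : CompleteSpace Θ := hΘ.completeSpace_coe
  let v : {A : Set Ω // MeasurableSet A} → Lp ℝ 2 ν := fun A =>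
    indicatorConstLp 2 A.2 (measure_ne_top ν _) (1 : ℝ)
  let Γ : Submodule ℝ (Lp ℝ 2 ν) := Submodule.span ℝ ((fun A => Θ.starProjection (v A)) '' F)
  have hfin : FiniteDimensional ℝ Γ :=
    FiniteDimensional.span_of_finite ℝ (F.finite_toSet.image _)
  have hΓ : Γ ≤ Θ := by
    refine Submodule.span_le.2 ?_
    rintro _ ⟨A, _, rfl⟩
    exact Θ.starProjection_apply_mem _
  have hval : ∀ A ∈ F, ∀ f ∈ Θ, ∫ t in A.1, f t ∂ν
      = inner ℝ (Θ.starProjection (v A)) (Γ.starProjection f) := by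
    intro A hA f hf
    rw [← Γ.inner_starProjection_left_eq_right, (Γ.starProjection_eq_self_iff).2
      (Submodule.subset_span ⟨A, hA, rfl⟩), Θ.inner_starProjection_left_eq_right,
      (Θ.starProjection_eq_self_iff).2 hf, L2.inner_indicatorConstLp_one]
  set C : ℝ := ∑ A ∈ F, ‖v A‖ with hC
  have hC0 : 0 ≤ C := Finset.sum_nonneg fun _ _ => norm_nonneg _
  have hsep : ∀ f ∈ Θ₀, ∀ g ∈ Θ₁, δ ≤ (C + 1) * ‖Γ.starProjection f - Γ.starProjection g‖ := by
    intro f hf g hg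
    obtain ⟨A, hA, hle⟩ := hF f hf g hg
    rw [hval A hA f (hΘ₀ hf), hval A hA g (hΘ₁ hg), ← inner_sub_right] at hle
    refine hle.trans ((abs_real_inner_le_norm _ _).trans ?_)
    gcongr
    have h₁ := Θ.norm_starProjection_apply_le (v A)
    have h₂ : ‖v A‖ ≤ C := Finset.single_le_sum (f := fun A => ‖v A‖)
      (fun _ _ => norm_nonneg _) hA
    linarith
  have hcl : ∀ s : Set (Lp ℝ 2 ν), closure (Γ.starProjection '' closure s)
      = closure (Γ.starProjection '' s) := fun s =>
    closure_image_closure Γ.starProjection.continuous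
  refine ⟨Γ, hfin, hΓ, ?_⟩
  rw [hcl, hcl, Set.disjoint_left]
  intro x hx₀ hx₁
  obtain ⟨_, ⟨f, hf, rfl⟩, hd₀⟩ := Metric.mem_closure_iff.1 hx₀ (δ / (C + 1) / 2) (by positivity)
  obtain ⟨_, ⟨g, hg, rfl⟩, hd₁⟩ := Metric.mem_closure_iff.1 hx₁ (δ / (C + 1) / 2) (by positivity)
  have h₁ := hsep f hf g hg
  rw [← dist_eq_norm, mul_comm, ← div_le_iff₀ (by positivity)] at h₁
  have := dist_triangle_left (Γ.starProjection f) (Γ.starProjection g) x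
  linarith

end Separation

section SetwiseAsymptotics

open scoped NNReal

variable {X Y ι : Type*} [MeasurableSpace X] [MeasurableSpace Y]

/-- The measures `μ i` are uniformly absolutely continuous with respect to `Q`. -/
def UniformlyAC (μ : ι → Measure X) (Q : Measure X) : Prop :=
  ∀ ε : ℝ≥0, 0 < ε → ∃ M : ℝ≥0, ∀ i A, MeasurableSet A → μ i A ≤ M * Q A + ε

/-- The difference of the measures `μ i` and `μ' i` tends to zero on each measurable set. -/
def SetwiseClose (l : Filter ι) (μ μ' : ι → Measure X) : Prop :=
  ∀ A, MeasurableSet A → Tendsto (fun i => (μ i).real A - (μ' i).real A) l (𝓝 0)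

theorem UniformlyAC.map {μ : ι → Measure X} {Q : Measure X} (h : UniformlyAC μ Q) {f : X → Y}
    (hf : Measurable f) : UniformlyAC (fun i => (μ i).map f) (Q.map f) := by
  intro ε hε
  obtain ⟨M, hM⟩ := h ε hε
  refine ⟨M, fun i A hA => ?_⟩
  simpa only [Measure.map_apply hf hA] using hM i _ (hf hA)

theorem UniformlyAC.smul_le_one {μ : ι → Measure X} {Q : Measure X} (h : UniformlyAC μ Q)
    {c : ι → ℝ≥0∞} (hc : ∀ i, c i ≤ 1) : UniformlyAC (fun i => c i • μ i) Q := by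
  intro ε hε
  obtain ⟨M, hM⟩ := h ε hε
  refine ⟨M, fun i A hA => ?_⟩
  rw [Measure.smul_apply, smul_eq_mul]
  exact (mul_le_of_le_one_left' (hc i)).trans (hM i A hA)

theorem UniformlyAC.mono_right {μ : ι → Measure X} {Q Q' : Measure X} (h : UniformlyAC μ Q)
    {c : ℝ≥0} (hc : ∀ A, MeasurableSet A → Q A ≤ c * Q' A) : UniformlyAC μ Q' := by
  intro ε hε
  obtain ⟨M, hM⟩ := h ε hε
  refine ⟨M * c, fun i A hA => (hM i A hA).trans ?_⟩
  rw [ENNReal.coe_mul, mul_assoc]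
  gcongr
  exact hc A hA

theorem UniformlyAC.prod {μ : ι → Measure X} {Q : Measure X} {ρ : ι → Measure Y} {S : Measure Y}
    [∀ i, SFinite (μ i)] [∀ i, SFinite (ρ i)] [SFinite Q] [IsFiniteMeasure S]
    (h : UniformlyAC μ Q) (h' : UniformlyAC ρ S) {R : ℝ≥0} (hR : ∀ i, μ i Set.univ ≤ R) :
    UniformlyAC (fun i => (μ i).prod (ρ i)) (Q.prod S) := by
  intro ε hε
  obtain ⟨M, hM⟩ := h' (ε / 2 / (R + 1)) (by positivity)
  set s : ℝ≥0 := (S Set.univ).toNNReal with hs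
  have hS : S Set.univ = s := (ENNReal.coe_toNNReal (measure_ne_top _ _)).symm
  obtain ⟨M', hM'⟩ := h (ε / 2 / (M * s + 1)) (by positivity)
  refine ⟨M * M', fun i A hA => ?_⟩
  calc ((μ i).prod (ρ i)) A = ∫⁻ x, ρ i (Prod.mk x ⁻¹' A) ∂μ i := Measure.prod_apply hA
    _ ≤ ∫⁻ x, (M * S (Prod.mk x ⁻¹' A) + (ε / 2 / (R + 1) : ℝ≥0)) ∂μ i :=
        lintegral_mono fun x => hM i _ (measurable_prodMk_left hA)
    _ = M * ((μ i).prod S) A + (ε / 2 / (R + 1) : ℝ≥0) * μ i Set.univ := by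
        rw [lintegral_add_right _ measurable_const, lintegral_const_mul _
          (measurable_measure_prodMk_left hA), lintegral_const, Measure.prod_apply hA]
    _ ≤ M * ((μ i).prod S) A + (ε / 2 : ℝ≥0) := by
        gcongr
        refine (mul_le_mul_right (hR i) _).trans ?_
        rw [← ENNReal.coe_mul, ENNReal.coe_le_coe, div_mul_eq_mul_div]
        refine div_le_of_le_mul₀ (by positivity) (by positivity) ?_
        gcongr
        exact le_self_add
    _ = M * (∫⁻ y, μ i ((fun x => (x, y)) ⁻¹' A) ∂S) + (ε / 2 : ℝ≥0) := by
        rw [Measure.prod_apply_symm hA]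
    _ ≤ M * (∫⁻ y, (M' * Q ((fun x => (x, y)) ⁻¹' A) + (ε / 2 / (M * s + 1) : ℝ≥0)) ∂S)
          + (ε / 2 : ℝ≥0) := by
        gcongr with y
        exact hM' i _ (measurable_prodMk_right hA)
    _ = (M * M' : ℝ≥0) * (Q.prod S) A + (M * (ε / 2 / (M * s + 1)) * s : ℝ≥0)
          + (ε / 2 : ℝ≥0) := by
        rw [lintegral_add_right _ measurable_const, lintegral_const_mul _
          (measurable_measure_prodMk_right hA), lintegral_const, Measure.prod_apply_symm hA, hS]
        push_cast
        ring
    _ ≤ (M * M' : ℝ≥0) * (Q.prod S) A + (ε / 2 : ℝ≥0) + (ε / 2 : ℝ≥0) := by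
        gcongr
        rw [mul_right_comm, mul_div_assoc']
        refine div_le_of_le_mul₀ (by positivity) (by positivity) ?_
        rw [mul_comm]
        gcongr
        exact le_self_add
    _ = (M * M' : ℝ≥0) * (Q.prod S) A + ε := by
        rw [add_assoc, ← ENNReal.coe_add, add_halves]

theorem UniformlyAC.pi {μ : ι → Measure X} {Q : Measure X} [∀ i, IsFiniteMeasure (μ i)]
    [IsFiniteMeasure Q] (h : UniformlyAC μ Q) {R : ℝ≥0} (hR : ∀ i, μ i Set.univ ≤ R) (k : ℕ) :
    UniformlyAC (fun i => Measure.pi fun _ : Fin k => μ i) (Measure.pi fun _ : Fin k => Q) := by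
  induction k with
  | zero =>
    refine fun ε _ => ⟨1, fun i A hA => ?_⟩
    change (Measure.pi fun _ : Fin 0 => μ i) A ≤ _
    rw [Measure.pi_of_empty, Measure.pi_of_empty]
    simp
  | succ k ih =>
    have h₁ := (h.prod ih hR).map (MeasurableEquiv.piFinSuccAbove (fun _ => X) 0).symm.measurable
    have h₂ : ∀ (ρ : Measure X) [IsFiniteMeasure ρ], (Measure.pi fun _ : Fin (k + 1) => ρ)
        = (ρ.prod (Measure.pi fun _ : Fin k => ρ)).map
          (MeasurableEquiv.piFinSuccAbove (fun _ => X) 0).symm := fun ρ _ =>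
      ((measurePreserving_piFinSuccAbove (fun _ : Fin (k + 1) => ρ) 0).symm).map_eq.symm
    simpa only [h₂] using h₁

theorem UniformlyAC.sum {ρ : ℕ → ι → Measure X} {Q : Measure X} (h : ∀ k, UniformlyAC (ρ k) Q)
    {b : ℕ → ℝ≥0∞} (hb : ∑' k, b k ≠ ∞) (hρ : ∀ k i, ρ k i Set.univ ≤ b k) :
    UniformlyAC (fun i => Measure.sum fun k => ρ k i) Q := by
  intro ε hε
  have hε' : (0 : ℝ≥0∞) < (ε / 2 : ℝ≥0) := by
    rw [ENNReal.coe_pos]; positivity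
  obtain ⟨N, hN⟩ := ((ENNReal.tendsto_sum_nat_add b hb).eventually (gt_mem_nhds hε')).exists
  choose M hM using fun k => h k (ε / 2 / (N + 1)) (by positivity)
  refine ⟨∑ k ∈ Finset.range N, M k, fun i A hA => ?_⟩
  rw [Measure.sum_apply _ hA,
    ← Summable.sum_add_tsum_nat_add' (k := N) (f := fun k => ρ k i A) ENNReal.summable]
  have h₁ : ∑' k, ρ (k + N) i A ≤ (ε / 2 : ℝ≥0) :=
    (ENNReal.tsum_le_tsum fun k => (measure_mono (Set.subset_univ A)).trans (hρ _ i)).trans hN.le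
  have h₂ : ∑ k ∈ Finset.range N, ρ k i A
      ≤ ((∑ k ∈ Finset.range N, M k : ℝ≥0) : ℝ≥0∞) * Q A + (ε / 2 : ℝ≥0) := by
    refine (Finset.sum_le_sum fun k _ => hM k i A hA).trans ?_
    rw [Finset.sum_add_distrib, ← Finset.sum_mul, ENNReal.ofNNReal_finsetSum, Finset.sum_const,
      Finset.card_range, ← ENNReal.coe_nsmul]
    gcongr
    rw [nsmul_eq_mul, mul_div_assoc']
    refine div_le_of_le_mul₀ (by positivity) (by positivity) ?_
    rw [mul_comm]
    gcongr
    exact le_self_add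
  refine (add_le_add h₂ h₁).trans ?_
  rw [add_assoc, ← ENNReal.coe_add, add_halves]

theorem SetwiseClose.of_isPiSystem {l : Filter ι} {μ μ' : ι → Measure X} {Q : Measure X}
    [∀ i, IsFiniteMeasure (μ i)] [∀ i, IsFiniteMeasure (μ' i)] [IsFiniteMeasure Q]
    (h : UniformlyAC μ Q) (h' : UniformlyAC μ' Q) {C : Set (Set X)}
    (hC : ‹MeasurableSpace X› = MeasurableSpace.generateFrom C) (hpi : IsPiSystem C)
    (huniv : Tendsto (fun i => (μ i).real Set.univ - (μ' i).real Set.univ) l (𝓝 0))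
    (hbasic : ∀ A ∈ C, Tendsto (fun i => (μ i).real A - (μ' i).real A) l (𝓝 0)) :
    SetwiseClose l μ μ' := by
  intro A hA
  induction A, hA using MeasurableSpace.induction_on_inter hC hpi with
  | empty => simp [tendsto_const_nhds]
  | basic A hA => exact hbasic A hA
  | compl A hA ih =>
    have := huniv.sub ih
    rw [sub_zero] at this
    refine this.congr fun i => ?_
    rw [measureReal_compl hA, measureReal_compl hA]
    ring
  | iUnion f hd hf ih =>
    have hsplit : ∀ (ρ : Measure X) [IsFiniteMeasure ρ] (N : ℕ), ρ.real (⋃ k, f k)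
        = ∑ k ∈ Finset.range N, ρ.real (f k) + ρ.real (⋃ k ≥ N, f k) := by
      intro ρ _ N
      have hU : (⋃ k, f k) = (⋃ k ∈ Finset.range N, f k) ∪ ⋃ k ≥ N, f k := by
        ext x
        simp only [Set.mem_iUnion, Set.mem_union, Finset.mem_range, exists_prop]
        constructor
        · rintro ⟨k, hk⟩
          rcases lt_or_ge k N with hkN | hkN
          · exact Or.inl ⟨k, hkN, hk⟩
          · exact Or.inr ⟨k, hkN, hk⟩
        · rintro (⟨k, _, hk⟩ | ⟨k, _, hk⟩) <;> exact ⟨k, hk⟩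
      have hdis : Disjoint (⋃ k ∈ Finset.range N, f k) (⋃ k ≥ N, f k) := by
        simp only [Set.disjoint_iUnion_left, Set.disjoint_iUnion_right, Finset.mem_range]
        exact fun i hi j hj => hd (by omega)
      rw [hU, measureReal_union hdis (MeasurableSet.iUnion fun k => .iUnion fun _ => hf k)
          (measure_ne_top _ _) (measure_ne_top _ _),
        measureReal_biUnion_finset (fun i _ j _ hij => hd hij) fun k _ => hf k]
    rw [Metric.tendsto_nhds]
    intro ε hε
    set e : ℝ≥0 := ⟨ε / 8, by positivity⟩ with he
    have he0 : 0 < e := by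
      rw [← NNReal.coe_pos]; change 0 < ε / 8; positivity
    obtain ⟨M, hM⟩ := h e he0
    obtain ⟨M', hM'⟩ := h' e he0
    have hQ := tendsto_measure_biUnion_Ici_zero_of_pairwise_disjoint (μ := Q)
      (fun k => (hf k).nullMeasurableSet) hd
    have hpos : (0 : ℝ≥0∞) < (e / (M + M' + 1) : ℝ≥0) := by
      rw [ENNReal.coe_pos]; positivity
    obtain ⟨N, hN⟩ := (hQ.eventually (gt_mem_nhds hpos)).exists
    set T : Set X := ⋃ k ≥ N, f k with hT
    have hTm : MeasurableSet T := MeasurableSet.iUnion fun k => .iUnion fun _ => hf k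
    have htail : ∀ (ρ : Measure X) (L : ℝ≥0), L ≤ M + M' + 1 → ρ T ≤ L * Q T + e →
        ρ.real T ≤ ε / 4 := by
      intro ρ L hL hle
      have h₁ : (L : ℝ≥0∞) * Q T ≤ e := by
        calc (L : ℝ≥0∞) * Q T ≤ (M + M' + 1 : ℝ≥0) * (e / (M + M' + 1) : ℝ≥0) := by
              gcongr
              exact hN.le
          _ = e := by
              rw [← ENNReal.coe_mul, mul_div_cancel₀ _ (by positivity)]
      have h₂ : ρ T ≤ (e + e : ℝ≥0) := by
        refine hle.trans ?_
        rw [ENNReal.coe_add]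
        gcongr
      refine (ENNReal.toReal_mono ENNReal.coe_ne_top h₂).trans ?_
      rw [ENNReal.coe_toReal, NNReal.coe_add]
      change ε / 8 + ε / 8 ≤ ε / 4
      linarith
    have hsum : Tendsto (fun i => ∑ k ∈ Finset.range N, ((μ i).real (f k) - (μ' i).real (f k)))
        l (𝓝 0) := by
      simpa using tendsto_finsetSum (Finset.range N) fun k _ => ih k
    filter_upwards [Metric.tendsto_nhds.1 hsum (ε / 4) (by positivity)] with i hi
    rw [Real.dist_eq, sub_zero, Finset.sum_sub_distrib] at hi
    rw [Real.dist_eq, sub_zero, hsplit (μ i) N, hsplit (μ' i) N]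
    have h₁ := htail (μ i) M (by rw [add_assoc]; exact le_self_add) (hM i T hTm)
    have h₂ := htail (μ' i) M' (by rw [add_comm M, add_assoc]; exact le_self_add) (hM' i T hTm)
    have h₃ : 0 ≤ (μ i).real T := measureReal_nonneg
    have h₄ : 0 ≤ (μ' i).real T := measureReal_nonneg
    rw [abs_lt] at hi ⊢
    constructor <;> linarith [hi.1, hi.2]

theorem tendsto_mul_sub_mul {l : Filter ι} {a b c d : ι → ℝ} {R S : ℝ}
    (h : Tendsto (fun i => a i - b i) l (𝓝 0)) (h' : Tendsto (fun i => c i - d i) l (𝓝 0))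
    (hb : ∀ i, |b i| ≤ R) (hc : ∀ i, |c i| ≤ S) :
    Tendsto (fun i => a i * c i - b i * d i) l (𝓝 0) := by
  have ht : Tendsto (fun i => |a i - b i| * S + R * |c i - d i|) l (𝓝 0) := by
    simpa using (h.abs.mul_const S).add (h'.abs.const_mul R)
  refine squeeze_zero_norm (fun i => ?_) ht
  rw [Real.norm_eq_abs,
    show a i * c i - b i * d i = (a i - b i) * c i + b i * (c i - d i) by ring]
  refine (abs_add_le _ _).trans ?_
  rw [abs_mul, abs_mul]
  gcongr
  · exact hc i
  · exact hb i

theorem tendsto_prod_sub_prod {κ : Type*} {l : Filter ι} (s : Finset κ) {a b : κ → ι → ℝ} {R : ℝ}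
    (h : ∀ k, Tendsto (fun i => a k i - b k i) l (𝓝 0))
    (ha : ∀ k i, |a k i| ≤ R) (hb : ∀ k i, |b k i| ≤ R) :
    Tendsto (fun i => ∏ k ∈ s, a k i - ∏ k ∈ s, b k i) l (𝓝 0) := by
  classical
  induction s using Finset.induction_on with
  | empty => simp [tendsto_const_nhds]
  | insert k s hk ih =>
    simp only [Finset.prod_insert hk]
    refine tendsto_mul_sub_mul (h k) ih (hb k) (S := ∏ _k ∈ s, R) fun i => ?_
    rw [Finset.abs_prod]
    exact Finset.prod_le_prod (fun _ _ => abs_nonneg _) fun k _ => ha k i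

theorem SetwiseClose.pi {l : Filter ι} {μ μ' : ι → Measure X} {Q : Measure X}
    [∀ i, IsFiniteMeasure (μ i)] [∀ i, IsFiniteMeasure (μ' i)] [IsFiniteMeasure Q]
    (hμ : UniformlyAC μ Q) (hμ' : UniformlyAC μ' Q) (h : SetwiseClose l μ μ') {R : ℝ≥0}
    (hR : ∀ i, μ i Set.univ ≤ R) (hR' : ∀ i, μ' i Set.univ ≤ R) (k : ℕ) :
    SetwiseClose l (fun i => Measure.pi fun _ : Fin k => μ i)
      (fun i => Measure.pi fun _ : Fin k => μ' i) := by
  have hle : ∀ (ρ : Measure X), ρ Set.univ ≤ R → ∀ A, |ρ.real A| ≤ R := by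
    intro ρ hρ A
    rw [abs_of_nonneg measureReal_nonneg]
    exact ENNReal.toReal_mono ENNReal.coe_ne_top ((measure_mono (Set.subset_univ A)).trans hρ)
  have hbox : ∀ t : Fin k → Set X, (∀ j, MeasurableSet (t j)) →
      Tendsto (fun i => (Measure.pi fun _ : Fin k => μ i).real (Set.univ.pi t)
        - (Measure.pi fun _ : Fin k => μ' i).real (Set.univ.pi t)) l (𝓝 0) := by
    intro t ht
    simp only [measureReal_def, Measure.pi_pi, ENNReal.toReal_prod]
    exact tendsto_prod_sub_prod _ (fun j => h _ (ht j)) (fun j i => hle _ (hR i) _)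
      fun j i => hle _ (hR' i) _
  refine SetwiseClose.of_isPiSystem (hμ.pi hR k) (hμ'.pi hR' k) generateFrom_pi.symm
    isPiSystem_pi ?_ ?_
  · simpa using hbox (fun _ => Set.univ) fun _ => MeasurableSet.univ
  · rintro _ ⟨t, ht, rfl⟩
    exact hbox t fun j => ht j (Set.mem_univ j)

theorem SetwiseClose.tendsto_integral {l : Filter ι} {μ μ' : ι → Measure X}
    [∀ i, IsProbabilityMeasure (μ i)] [∀ i, IsProbabilityMeasure (μ' i)]
    (h : SetwiseClose l μ μ') {K : X → ℝ} (hK : Measurable K) (h0 : ∀ x, 0 ≤ K x)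
    (h1 : ∀ x, K x ≤ 1) :
    Tendsto (fun i => ∫ x, K x ∂(μ i) - ∫ x, K x ∂(μ' i)) l (𝓝 0) := by
  have happrox : ∀ N : ℕ, 0 < N → ∀ (ρ : Measure X) [IsProbabilityMeasure ρ],
      |∫ x, K x ∂ρ - (1 / N) * ∑ j ∈ Finset.range N, ρ.real {x | ((j + 1 : ℕ) : ℝ) ≤ N * K x}|
        ≤ 1 / N := by
    intro N hN ρ _
    have hN' : (0 : ℝ) < N := by exact_mod_cast hN
    have hm : ∀ j : ℕ, MeasurableSet {x | ((j + 1 : ℕ) : ℝ) ≤ N * K x} := fun j =>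
      measurableSet_le measurable_const (hK.const_mul _)
    have hfl : ∀ x, ∑ j ∈ Finset.range N,
        Set.indicator {x | ((j + 1 : ℕ) : ℝ) ≤ N * K x} (fun _ => (1 : ℝ)) x
          = ⌊(N : ℝ) * K x⌋₊ := by
      intro x
      have hx : 0 ≤ (N : ℝ) * K x := mul_nonneg hN'.le (h0 x)
      have hle : ⌊(N : ℝ) * K x⌋₊ ≤ N :=
        Nat.floor_le_of_le (mul_le_of_le_one_right hN'.le (h1 x))
      simp only [Set.indicator_apply, Set.mem_ofPred_eq, ← Nat.le_floor_iff hx, Finset.sum_boole]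
      congr 1
      rw [show (Finset.range N).filter (fun j => j + 1 ≤ ⌊(N : ℝ) * K x⌋₊)
        = Finset.range ⌊(N : ℝ) * K x⌋₊ by ext j; simp; omega, Finset.card_range]
    have hi : ∀ j : ℕ, Integrable
        (Set.indicator {x | ((j + 1 : ℕ) : ℝ) ≤ N * K x} fun _ => (1 : ℝ)) ρ := fun j =>
      (integrable_const 1).indicator (hm j)
    have hKi : Integrable K ρ := Integrable.of_bound hK.aestronglyMeasurable 1
      (ae_of_all _ fun x => by rw [Real.norm_eq_abs, abs_of_nonneg (h0 x)]; exact h1 x)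
    have hsum : ∑ j ∈ Finset.range N, ρ.real {x | ((j + 1 : ℕ) : ℝ) ≤ N * K x}
        = ∫ x, (⌊(N : ℝ) * K x⌋₊ : ℝ) ∂ρ := by
      simp only [← hfl]
      rw [integral_finsetSum _ fun j _ => hi j]
      exact Finset.sum_congr rfl fun j _ => by
        rw [integral_indicator_const _ (hm j), smul_eq_mul, mul_one]
    have hfi : Integrable (fun x => (⌊(N : ℝ) * K x⌋₊ : ℝ)) ρ := by
      simp only [← hfl]
      exact integrable_finsetSum _ fun j _ => hi j
    rw [hsum, ← integral_const_mul, ← integral_sub hKi (hfi.const_mul _), ← Real.norm_eq_abs]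
    refine (norm_integral_le_of_norm_le_const (C := 1 / (N : ℝ)) (ae_of_all _ fun x => ?_)).trans
      (by simp)
    have h₁ := Nat.floor_le (mul_nonneg hN'.le (h0 x))
    have h₂ := Nat.lt_floor_add_one ((N : ℝ) * K x)
    rw [Real.norm_eq_abs, show K x - 1 / N * (⌊(N : ℝ) * K x⌋₊ : ℝ)
      = (N * K x - ⌊(N : ℝ) * K x⌋₊) / N by field_simp, abs_div, abs_of_pos hN']
    gcongr
    rw [abs_le]
    constructor <;> linarith
  rw [Metric.tendsto_nhds]
  intro ε hε
  obtain ⟨n, hn⟩ := exists_nat_one_div_lt (show 0 < ε / 4 by positivity)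
  have hs : Tendsto (fun i => (1 / ((n + 1 : ℕ) : ℝ)) * ∑ j ∈ Finset.range (n + 1),
      ((μ i).real {x | ((j + 1 : ℕ) : ℝ) ≤ (n + 1 : ℕ) * K x}
        - (μ' i).real {x | ((j + 1 : ℕ) : ℝ) ≤ (n + 1 : ℕ) * K x})) l (𝓝 0) := by
    simpa using (tendsto_finsetSum (Finset.range (n + 1)) fun j _ => h _
      (measurableSet_le (measurable_const (a := ((j + 1 : ℕ) : ℝ)))
        (hK.const_mul ((n + 1 : ℕ) : ℝ)))).const_mul (1 / ((n + 1 : ℕ) : ℝ))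
  filter_upwards [Metric.tendsto_nhds.1 hs (ε / 4) (by positivity)] with i hi
  rw [Real.dist_eq, sub_zero, Finset.sum_sub_distrib, mul_sub] at hi
  rw [Real.dist_eq, sub_zero]
  have h₁ := happrox (n + 1) n.succ_pos (μ i)
  have h₂ := happrox (n + 1) n.succ_pos (μ' i)
  have h₃ : 1 / ((n + 1 : ℕ) : ℝ) < ε / 4 := by exact_mod_cast hn
  rw [abs_lt] at hi ⊢
  rw [abs_le] at h₁ h₂
  constructor <;> linarith [hi.1, hi.2, h₁.1, h₁.2, h₂.1, h₂.2]

end SetwiseAsymptotics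

section PoissonAsymptotics

open scoped NNReal

variable {Ω ι : Type*} [MeasurableSpace Ω]

theorem poissonLaw_real_apply (μ : Measure Ω) [IsFiniteMeasure μ] {A : Set (Measure Ω)}
    (hA : MeasurableSet A) :
    (poissonLaw μ).real A = ∑' k : ℕ, Real.exp (-μ.real Set.univ) / (k.factorial : ℝ) *
      (Measure.pi fun _ : Fin k => μ).real (atoms ⁻¹' A) := by
  rw [measureReal_def, poissonLaw, Measure.sum_apply _ hA, ENNReal.tsum_toReal_eq]
  · refine tsum_congr fun k => ?_
    rw [Measure.smul_apply, Measure.map_apply (measurable_atoms k) hA, smul_eq_mul,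
      ENNReal.toReal_mul, ENNReal.toReal_ofReal (by positivity)]
    rfl
  · intro k
    rw [Measure.smul_apply, Measure.map_apply (measurable_atoms k) hA]
    exact ENNReal.mul_ne_top ENNReal.ofReal_ne_top (measure_ne_top _ _)

theorem measureReal_pi_le {μ : Measure Ω} [IsFiniteMeasure μ] {R : ℝ≥0} (hR : μ Set.univ ≤ R)
    {k : ℕ} (A : Set (Fin k → Ω)) : (Measure.pi fun _ : Fin k => μ).real A ≤ (R : ℝ) ^ k := by
  have : (Measure.pi fun _ : Fin k => μ) A ≤ (R ^ k : ℝ≥0) := by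
    refine (measure_mono (Set.subset_univ A)).trans ?_
    rw [Measure.pi_univ, Finset.prod_const, Finset.card_univ, Fintype.card_fin, ENNReal.coe_pow]
    gcongr
  simpa [measureReal_def] using ENNReal.toReal_mono ENNReal.coe_ne_top this

theorem exp_neg_div_factorial_le_one {x : ℝ} (hx : 0 ≤ x) (k : ℕ) :
    Real.exp (-x) / (k.factorial : ℝ) ≤ 1 := by
  have h₁ : Real.exp (-x) ≤ 1 := Real.exp_le_one_iff.2 (neg_nonpos.2 hx)
  have h₂ : (1 : ℝ) ≤ k.factorial := by exact_mod_cast k.factorial_pos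
  rw [div_le_one (by positivity)]
  exact h₁.trans h₂

theorem UniformlyAC.poissonLaw {μ : ι → Measure Ω} {Q : Measure Ω} [∀ i, IsFiniteMeasure (μ i)]
    [IsFiniteMeasure Q] (h : UniformlyAC μ Q) {R : ℝ≥0} (hR : ∀ i, μ i Set.univ ≤ R) :
    UniformlyAC (fun i => poissonLaw (μ i)) (poissonLaw Q) := by
  refine UniformlyAC.sum (b := fun k => ENNReal.ofReal ((R : ℝ) ^ k / (k.factorial : ℝ)))
    (fun k => ?_) (Real.summable_pow_div_factorial R).tsum_ofReal_ne_top fun k i => ?_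
  · refine (((h.pi hR k).map (measurable_atoms k)).smul_le_one fun i => ?_).mono_right
      (c := ((Real.exp (-(Q Set.univ).toReal) / (k.factorial : ℝ)).toNNReal)⁻¹) fun A hA => ?_
    · rw [← ENNReal.ofReal_one]
      exact ENNReal.ofReal_le_ofReal (exp_neg_div_factorial_le_one ENNReal.toReal_nonneg k)
    · have hw : (Real.exp (-(Q Set.univ).toReal) / (k.factorial : ℝ)).toNNReal ≠ 0 := by
        rw [Ne, Real.toNNReal_eq_zero, not_le]; positivity
      have hle := ENNReal.le_tsum (f := fun k : ℕ =>
        (ENNReal.ofReal (Real.exp (-(Q Set.univ).toReal) / (k.factorial : ℝ)) •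
          (Measure.pi fun _ : Fin k => Q).map atoms) A) k
      rw [PoissonTesting.poissonLaw, Measure.sum_apply _ hA]
      refine le_trans ?_ (mul_le_mul_right hle _)
      rw [Measure.smul_apply, smul_eq_mul, ENNReal.ofReal, ← mul_assoc, ← ENNReal.coe_mul,
        inv_mul_cancel₀ hw, ENNReal.coe_one, one_mul]
  · rw [Measure.smul_apply, Measure.map_apply (measurable_atoms k) MeasurableSet.univ,
      Set.preimage_univ, smul_eq_mul,
      ← ofReal_measureReal (μ := Measure.pi fun _ : Fin k => μ i), ← ENNReal.ofReal_mul (by positivity)]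
    refine ENNReal.ofReal_le_ofReal ?_
    rw [div_mul_eq_mul_div]
    gcongr
    have h₁ := measureReal_pi_le (hR i) (Set.univ : Set (Fin k → Ω))
    have h₂ : Real.exp (-(μ i Set.univ).toReal) ≤ 1 :=
      Real.exp_le_one_iff.2 (neg_nonpos.2 ENNReal.toReal_nonneg)
    calc _ ≤ 1 * (R : ℝ) ^ k := by gcongr
      _ = _ := one_mul _

theorem exp_neg_sub_exp_neg_le {x y : ℝ} (hx : 0 ≤ x) :
    Real.exp (-x) - Real.exp (-y) ≤ |x - y| := by
  have h₁ := Real.add_one_le_exp (x - y)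
  have h₂ : Real.exp (-y) = Real.exp (-x) * Real.exp (x - y) := by
    rw [← Real.exp_add]; ring_nf
  have h₃ : Real.exp (-x) ≤ 1 := Real.exp_le_one_iff.2 (neg_nonpos.2 hx)
  have h₄ := Real.exp_pos (-x)
  have h₅ := neg_abs_le (x - y)
  have h₆ := abs_nonneg (x - y)
  nlinarith [mul_le_mul_of_nonneg_left h₁ h₄.le]

theorem SetwiseClose.poissonLaw {l : Filter ι} {μ μ' : ι → Measure Ω} {Q : Measure Ω}
    [∀ i, IsFiniteMeasure (μ i)] [∀ i, IsFiniteMeasure (μ' i)] [IsFiniteMeasure Q]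
    (hμ : UniformlyAC μ Q) (hμ' : UniformlyAC μ' Q) (h : SetwiseClose l μ μ') {R : ℝ≥0}
    (hR : ∀ i, μ i Set.univ ≤ R) (hR' : ∀ i, μ' i Set.univ ≤ R) :
    SetwiseClose l (fun i => poissonLaw (μ i)) (fun i => poissonLaw (μ' i)) := by
  intro A hA
  have hbound : ∀ (ρ : Measure Ω) [IsFiniteMeasure ρ], ρ Set.univ ≤ R → ∀ k : ℕ,
      Real.exp (-ρ.real Set.univ) / (k.factorial : ℝ) *
        (Measure.pi fun _ : Fin k => ρ).real (atoms ⁻¹' A) ≤ (R : ℝ) ^ k / (k.factorial : ℝ) := by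
    intro ρ _ hρ k
    rw [div_mul_eq_mul_div]
    gcongr
    have h₁ := measureReal_pi_le hρ (atoms ⁻¹' A : Set (Fin k → Ω))
    have h₂ : Real.exp (-ρ.real Set.univ) ≤ 1 :=
      Real.exp_le_one_iff.2 (neg_nonpos.2 measureReal_nonneg)
    calc _ ≤ 1 * (R : ℝ) ^ k := by gcongr
      _ = _ := one_mul _
  have hnn : ∀ (ρ : Measure Ω) (k : ℕ), 0 ≤ Real.exp (-ρ.real Set.univ) / (k.factorial : ℝ) *
      (Measure.pi fun _ : Fin k => ρ).real (atoms ⁻¹' A) := fun ρ k => by positivity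
  have hsm := Real.summable_pow_div_factorial (R : ℝ)
  have hsum : ∀ (ρ : Measure Ω) [IsFiniteMeasure ρ], ρ Set.univ ≤ R →
      Summable fun k : ℕ => Real.exp (-ρ.real Set.univ) / (k.factorial : ℝ) *
        (Measure.pi fun _ : Fin k => ρ).real (atoms ⁻¹' A) := fun ρ _ hρ =>
    Summable.of_nonneg_of_le (hnn ρ) (hbound ρ hρ) hsm
  have hrw : ∀ i, (PoissonTesting.poissonLaw (μ i)).real A
      - (PoissonTesting.poissonLaw (μ' i)).real A = ∑' k : ℕ,
        (Real.exp (-(μ i).real Set.univ) / (k.factorial : ℝ) *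
            (Measure.pi fun _ : Fin k => μ i).real (atoms ⁻¹' A)
          - Real.exp (-(μ' i).real Set.univ) / (k.factorial : ℝ) *
            (Measure.pi fun _ : Fin k => μ' i).real (atoms ⁻¹' A)) := by
    intro i
    rw [poissonLaw_real_apply _ hA, poissonLaw_real_apply _ hA,
      (hsum (μ i) (hR i)).tsum_sub (hsum (μ' i) (hR' i))]
  simp only [hrw]
  have hexp : Tendsto (fun i => Real.exp (-(μ i).real Set.univ) - Real.exp (-(μ' i).real Set.univ))
      l (𝓝 0) := by
    refine squeeze_zero_norm (fun i => ?_)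
      (by simpa using (h Set.univ MeasurableSet.univ).abs)
    rw [Real.norm_eq_abs, abs_le']
    refine ⟨exp_neg_sub_exp_neg_le measureReal_nonneg, ?_⟩
    rw [neg_sub, abs_sub_comm]
    exact exp_neg_sub_exp_neg_le measureReal_nonneg
  rw [show (0 : ℝ) = ∑' _ : ℕ, (0 : ℝ) by simp]
  refine tendsto_tsum_of_dominated_convergence
    (bound := fun k : ℕ => (R : ℝ) ^ k / (k.factorial : ℝ)) hsm (fun k => ?_)
    (Eventually.of_forall fun i k => ?_)
  · refine tendsto_mul_sub_mul (R := 1) (S := (R : ℝ) ^ k) ?_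
      (h.pi hμ hμ' hR hR' k _ (measurable_atoms k hA)) (fun i => ?_) fun i => ?_
    · simpa [sub_div] using hexp.div_const (k.factorial : ℝ)
    · rw [abs_of_nonneg (by positivity)]
      exact exp_neg_div_factorial_le_one measureReal_nonneg k
    · rw [abs_of_nonneg measureReal_nonneg]
      exact measureReal_pi_le (hR i) _
  · rw [Real.norm_eq_abs, abs_le]
    have h₁ := hbound (μ i) (hR i) k
    have h₂ := hbound (μ' i) (hR' i) k
    have h₃ := hnn (μ i) k
    have h₄ := hnn (μ' i) k
    constructor <;> linarith

variable {ν : Measure Ω}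

instance isFiniteMeasure_meanMeasure [IsFiniteMeasure ν] (f : Lp ℝ 2 ν) : IsFiniteMeasure (meanMeasure f) :=
  isFiniteMeasure_withDensity_ofReal ((Lp.memLp f).integrable (by norm_num)).2

theorem meanMeasure_real_apply {f : Lp ℝ 2 ν} (hf : 0 ≤ᵐ[ν] f) {A : Set Ω}
    (hA : MeasurableSet A) : (meanMeasure f).real A = ∫ t in A, f t ∂ν := by
  rw [measureReal_def, meanMeasure, withDensity_apply _ hA,
    integral_eq_lintegral_of_nonneg_ae (ae_restrict_of_ae hf)
      (Lp.aestronglyMeasurable f).restrict]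

theorem uniformlyAC_meanMeasure {u : ι → Lp ℝ 2 ν} {R : ℝ} (hu : ∀ i, ‖u i‖ ≤ R) :
    UniformlyAC (fun i => meanMeasure (u i)) ν := by
  intro ε hε
  have hM : 0 < R ^ 2 / ε + 1 := by positivity
  refine ⟨(R ^ 2 / ε + 1).toNNReal, fun i A hA => ?_⟩
  set M : ℝ := R ^ 2 / ε + 1 with hMdef
  have hsq : Integrable (fun t => (u i t) ^ 2) ν := (Lp.memLp (u i)).integrable_sq
  have hnorm : ∫ t, (u i t) ^ 2 ∂ν = ‖u i‖ ^ 2 := by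
    rw [← real_inner_self_eq_norm_sq, L2.inner_def]
    refine integral_congr_ae (ae_of_all _ fun t => ?_)
    simp [sq]
  calc meanMeasure (u i) A = ∫⁻ t in A, ENNReal.ofReal (u i t) ∂ν := withDensity_apply _ hA
    _ ≤ ∫⁻ t in A, (ENNReal.ofReal M + ENNReal.ofReal ((u i t) ^ 2 / M)) ∂ν := by
        refine lintegral_mono fun t => ?_
        rw [← ENNReal.ofReal_add hM.le (by positivity)]
        refine ENNReal.ofReal_le_ofReal ?_
        rw [← sub_le_iff_le_add', le_div_iff₀ hM]
        nlinarith [sq_nonneg (u i t - M), sq_nonneg (u i t)]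
    _ = ENNReal.ofReal M * ν A + ∫⁻ t in A, ENNReal.ofReal ((u i t) ^ 2 / M) ∂ν := by
        rw [lintegral_add_left measurable_const, setLIntegral_const]
    _ ≤ ENNReal.ofReal M * ν A + ∫⁻ t, ENNReal.ofReal ((u i t) ^ 2 / M) ∂ν := by
        gcongr
        exact Measure.restrict_le_self
    _ ≤ ENNReal.ofReal M * ν A + ε := by
        gcongr
        rw [← ofReal_integral_eq_lintegral_ofReal (hsq.div_const M)
          (ae_of_all _ fun t => by positivity), integral_div, hnorm]
        refine ENNReal.ofReal_le_of_le_toReal ?_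
        rw [ENNReal.coe_toReal, div_le_iff₀ hM, hMdef]
        have h₁ : ‖u i‖ ^ 2 ≤ R ^ 2 := by gcongr; exact hu i
        have hε' : (0 : ℝ) < ε := hε
        have h₂ : (ε : ℝ) * (R ^ 2 / ε + 1) = R ^ 2 + ε := by field_simp
        linarith

variable [IsFiniteMeasure ν]

theorem UniformlyAC.exists_measure_univ_le {μ : ι → Measure Ω} (h : UniformlyAC μ ν) :
    ∃ R : ℝ≥0, ∀ i, μ i Set.univ ≤ R := by
  obtain ⟨M, hM⟩ := h 1 one_pos
  refine ⟨M * (ν Set.univ).toNNReal + 1, fun i => (hM i _ MeasurableSet.univ).trans ?_⟩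
  rw [ENNReal.coe_add, ENNReal.coe_mul, ENNReal.coe_toNNReal (measure_ne_top _ _)]

theorem integral_le_one_of_test {n : ℕ} (K : Test Ω n) (f : Lp ℝ 2 ν) :
    ∫ κ, K.toFun κ ∂(sampleLaw n f) ≤ 1 := by
  have := integral_mono_of_nonneg (μ := sampleLaw n f) (ae_of_all _ K.nonneg)
    (integrable_const (1 : ℝ)) (ae_of_all _ K.le_one)
  simpa using this

theorem integral_one_sub_test {n : ℕ} (K : Test Ω n) (f : Lp ℝ 2 ν) :
    ∫ κ, (1 - K.toFun κ) ∂(sampleLaw n f) = 1 - ∫ κ, K.toFun κ ∂(sampleLaw n f) := by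
  have hK : Integrable K.toFun (sampleLaw n f) :=
    Integrable.of_bound K.measurable.aestronglyMeasurable 1 (ae_of_all _ fun κ => by
      rw [Real.norm_eq_abs, abs_of_nonneg (K.nonneg κ)]; exact K.le_one κ)
  rw [integral_sub (integrable_const _) hK]
  simp

theorem integral_le_typeIError {n : ℕ} (K : Test Ω n) {Θ₀ : Set (Lp ℝ 2 ν)} {f : Lp ℝ 2 ν}
    (hf : f ∈ Θ₀) : ∫ κ, K.toFun κ ∂(sampleLaw n f) ≤ typeIError Θ₀ K := by
  refine le_ciSup (f := fun f : Θ₀ => ∫ κ, K.toFun κ ∂(sampleLaw n (f : Lp ℝ 2 ν)))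
    ⟨1, ?_⟩ ⟨f, hf⟩
  rintro _ ⟨g, rfl⟩
  exact integral_le_one_of_test K _

theorem integral_le_typeIIError {n : ℕ} (K : Test Ω n) {Θ₁ : Set (Lp ℝ 2 ν)} {f : Lp ℝ 2 ν}
    (hf : f ∈ Θ₁) : ∫ κ, (1 - K.toFun κ) ∂(sampleLaw n f) ≤ typeIIError Θ₁ K := by
  refine le_ciSup (f := fun f : Θ₁ => ∫ κ, (1 - K.toFun κ) ∂(sampleLaw n (f : Lp ℝ 2 ν)))
    ⟨1, ?_⟩ ⟨f, hf⟩
  rintro _ ⟨g, rfl⟩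
  change ∫ κ, (1 - K.toFun κ) ∂(sampleLaw n (g : Lp ℝ 2 ν)) ≤ 1
  rw [integral_one_sub_test]
  have := integral_nonneg_of_ae (μ := sampleLaw n (g : Lp ℝ 2 ν)) (ae_of_all _ K.nonneg)
  linarith

theorem indistinguishable_of_not_setwiseSeparated {Θ₀ Θ₁ : Set (Lp ℝ 2 ν)}
    (hpos₀ : ∀ f ∈ Θ₀, 0 ≤ᵐ[ν] f) (hpos₁ : ∀ f ∈ Θ₁, 0 ≤ᵐ[ν] f)
    (hbdd₀ : Bornology.IsBounded Θ₀) (hbdd₁ : Bornology.IsBounded Θ₁)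
    (h : ¬ SetwiseSeparated Θ₀ Θ₁) : Indistinguishable Θ₀ Θ₁ := by
  intro n _ K
  obtain ⟨f, g, hf, hg, hfg⟩ := exists_net_of_not_setwiseSeparated h
  obtain ⟨R₀, hR₀⟩ := hbdd₀.exists_norm_le
  obtain ⟨R₁, hR₁⟩ := hbdd₁.exists_norm_le
  have hfQ := uniformlyAC_meanMeasure fun i => hR₀ _ (hf i)
  have hgQ := uniformlyAC_meanMeasure fun i => hR₁ _ (hg i)
  obtain ⟨S₀, hS₀⟩ := hfQ.exists_measure_univ_le
  obtain ⟨S₁, hS₁⟩ := hgQ.exists_measure_univ_le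
  have hS₀' : ∀ i, meanMeasure (f i) Set.univ ≤ (max S₀ S₁ : ℝ≥0) := fun i =>
    (hS₀ i).trans (ENNReal.coe_le_coe.2 (le_max_left _ _))
  have hS₁' : ∀ i, meanMeasure (g i) Set.univ ≤ (max S₀ S₁ : ℝ≥0) := fun i =>
    (hS₁ i).trans (ENNReal.coe_le_coe.2 (le_max_right _ _))
  have hclose : SetwiseClose atTop (fun i => meanMeasure (f i)) (fun i => meanMeasure (g i)) :=
    fun A hA => (hfg A hA).congr fun i => by
      rw [meanMeasure_real_apply (hpos₀ _ (hf i)) hA, meanMeasure_real_apply (hpos₁ _ (hg i)) hA]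
  have hone : ∀ u : Lp ℝ 2 ν, poissonLaw (meanMeasure u) Set.univ ≤ (1 : ℝ≥0) := fun u => by
    rw [measure_univ, ENNReal.coe_one]
  have hP := (hclose.poissonLaw hfQ hgQ hS₀' hS₁').pi (hfQ.poissonLaw hS₀') (hgQ.poissonLaw hS₁')
    (fun i => hone (f i)) (fun i => hone (g i)) n
  have hlim := (hP.tendsto_integral K.measurable K.nonneg K.le_one).add_const 1
  rw [zero_add] at hlim
  refine le_of_tendsto hlim (Eventually.of_forall fun i => ?_)
  have h₁ := integral_le_typeIError K (hf i)
  have h₂ := integral_le_typeIIError K (hg i)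
  rw [integral_one_sub_test] at h₂
  unfold sampleLaw at h₁ h₂
  linarith

end PoissonAsymptotics

section Consistency

open scoped NNReal
open ProbabilityTheory

variable {Ω : Type*} [MeasurableSpace Ω]

theorem lintegral_poissonLaw (μ : Measure Ω) {F : Measure Ω → ℝ≥0∞} (hF : Measurable F) :
    ∫⁻ κ, F κ ∂(poissonLaw μ) = ∑' k : ℕ,
      ENNReal.ofReal (Real.exp (-(μ Set.univ).toReal) / (k.factorial : ℝ)) *
        ∫⁻ x, F (atoms x) ∂(Measure.pi fun _ : Fin k => μ) := by
  rw [poissonLaw, lintegral_sum_measure]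
  refine tsum_congr fun k => ?_
  rw [lintegral_smul_measure, lintegral_map hF (measurable_atoms k), smul_eq_mul]

theorem atoms_univ {k : ℕ} (x : Fin k → Ω) : atoms x Set.univ = k := by
  simp [atoms, Measure.finsetSum_apply]

theorem lintegral_atoms_apply (μ : Measure Ω) [IsFiniteMeasure μ] {A : Set Ω}
    (hA : MeasurableSet A) (k : ℕ) :
    ∫⁻ x, atoms x A ∂(Measure.pi fun _ : Fin k => μ) = k * (μ Set.univ ^ (k - 1) * μ A) := by
  have hm : ∀ j : Fin k, Measurable fun x : Fin k → Ω => Measure.dirac (x j) A := fun j =>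
    ((Measure.measurable_coe hA).comp Measure.measurable_dirac).comp (measurable_pi_apply j)
  simp only [atoms, Measure.finsetSum_apply]
  rw [lintegral_finsetSum _ fun j _ => hm j]
  have : ∀ j : Fin k, ∫⁻ x, Measure.dirac (x j) A ∂(Measure.pi fun _ : Fin k => μ)
      = μ Set.univ ^ (k - 1) * μ A := by
    intro j
    have h₁ := lintegral_map (μ := Measure.pi fun _ : Fin k => μ) (f := fun t => Measure.dirac t A)
      (g := Function.eval j) ((Measure.measurable_coe hA).comp Measure.measurable_dirac)
      (measurable_pi_apply j)
    rw [Measure.pi_map_eval, lintegral_smul_measure] at h₁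
    simp only [Function.eval] at h₁
    rw [← h₁]
    simp [Measure.dirac_apply' _ hA, lintegral_indicator_one hA, Finset.card_erase_of_mem]
  simp [this]

theorem lintegral_poissonLaw_apply (μ : Measure Ω) [IsFiniteMeasure μ] {A : Set Ω}
    (hA : MeasurableSet A) : ∫⁻ κ, κ A ∂(poissonLaw μ) = μ A := by
  have hone : ∑' k : ℕ, ENNReal.ofReal (Real.exp (-(μ Set.univ).toReal) / (k.factorial : ℝ)) *
      μ Set.univ ^ k = 1 := by
    have := lintegral_poissonLaw μ (measurable_const (a := (1 : ℝ≥0∞)))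
    simpa [Measure.pi_univ] using this.symm
  rw [lintegral_poissonLaw μ (Measure.measurable_coe hA)]
  simp only [lintegral_atoms_apply μ hA]
  rw [tsum_eq_zero_add' ENNReal.summable]
  simp only [Nat.cast_zero, zero_mul, mul_zero, zero_add, Nat.add_sub_cancel]
  calc _ = ∑' k : ℕ, (ENNReal.ofReal (Real.exp (-(μ Set.univ).toReal) / (k.factorial : ℝ)) *
      μ Set.univ ^ k) * μ A := by
        refine tsum_congr fun k => ?_
        rw [← mul_assoc, ← mul_assoc]
        congr 2
        rw [← ENNReal.ofReal_natCast, ← ENNReal.ofReal_mul (by positivity)]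
        congr 1
        rw [Nat.factorial_succ]
        push_cast
        field_simp
    _ = μ A := by rw [ENNReal.tsum_mul_right, hone, one_mul]

/-- A bound for the second moment of the number of points, depending only on a bound for the
mass of the mean measure. -/
theorem lintegral_poissonLaw_univ_sq_le {μ : Measure Ω} [IsFiniteMeasure μ] {R : ℝ≥0}
    (hR : μ Set.univ ≤ R) :
    ∫⁻ κ, κ Set.univ ^ 2 ∂(poissonLaw μ) ≤ ENNReal.ofReal (Real.exp (4 * R)) := by
  have hexp : Real.exp (4 * R) = ∑' k : ℕ, (4 * (R : ℝ)) ^ k / (k.factorial : ℝ) := by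
    rw [Real.exp_eq_exp_ℝ, NormedSpace.exp_eq_tsum_div]
  rw [lintegral_poissonLaw μ ((Measure.measurable_coe MeasurableSet.univ).pow_const 2), hexp,
    ENNReal.ofReal_tsum_of_nonneg
      (fun k => by positivity) (Real.summable_pow_div_factorial _)]
  refine ENNReal.tsum_le_tsum fun k => ?_
  simp only [atoms_univ]
  rw [lintegral_const, Measure.pi_univ, Finset.prod_const, Finset.card_univ, Fintype.card_fin]
  have h₁ : Real.exp (-(μ Set.univ).toReal) ≤ 1 :=
    Real.exp_le_one_iff.2 (neg_nonpos.2 ENNReal.toReal_nonneg)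
  have h₂ : (k : ℝ) ≤ 2 ^ k := by exact_mod_cast Nat.lt_two_pow_self.le
  calc _ ≤ ENNReal.ofReal (Real.exp (-(μ Set.univ).toReal) / (k.factorial : ℝ)) *
        (ENNReal.ofReal ((k : ℝ) ^ 2) * ENNReal.ofReal ((R : ℝ) ^ k)) := by
        rw [ENNReal.ofReal_pow (by positivity), ENNReal.ofReal_natCast,
          ENNReal.ofReal_pow (by positivity), ENNReal.ofReal_coe_nnreal]
        gcongr
    _ ≤ _ := by
        rw [← ENNReal.ofReal_mul (by positivity), ← ENNReal.ofReal_mul (by positivity)]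
        refine ENNReal.ofReal_le_ofReal ?_
        rw [div_mul_eq_mul_div]
        gcongr
        calc _ ≤ 1 * ((2 ^ k) ^ 2 * (R : ℝ) ^ k) := by gcongr
          _ = (4 * (R : ℝ)) ^ k := by
            rw [one_mul, ← pow_mul, mul_comm k 2, pow_mul, ← mul_pow]; norm_num

theorem measurable_toReal_apply {A : Set Ω} (hA : MeasurableSet A) :
    Measurable fun κ : Measure Ω => (κ A).toReal :=
  (Measure.measurable_coe hA).ennreal_toReal

theorem lintegral_enorm_sq_le {μ : Measure Ω} [IsFiniteMeasure μ] {R : ℝ≥0}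
    (hR : μ Set.univ ≤ R) (A : Set Ω) :
    ∫⁻ κ, ‖(κ A).toReal‖ₑ ^ 2 ∂(poissonLaw μ) ≤ ENNReal.ofReal (Real.exp (4 * R)) := by
  refine (lintegral_mono fun κ => ?_).trans (lintegral_poissonLaw_univ_sq_le hR)
  gcongr
  rw [Real.enorm_eq_ofReal ENNReal.toReal_nonneg]
  exact ENNReal.ofReal_toReal_le.trans (measure_mono (Set.subset_univ A))

theorem memLp_two_toReal_apply (μ : Measure Ω) [IsFiniteMeasure μ] {A : Set Ω}
    (hA : MeasurableSet A) : MemLp (fun κ : Measure Ω => (κ A).toReal) 2 (poissonLaw μ) := by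
  refine ⟨(measurable_toReal_apply hA).aestronglyMeasurable, ?_⟩
  rw [eLpNorm_lt_top_iff_lintegral_rpow_enorm_lt_top (by norm_num) (by norm_num)]
  have := lintegral_enorm_sq_le (μ := μ) (R := (μ Set.univ).toNNReal)
    (ENNReal.coe_toNNReal (measure_ne_top _ _)).ge A
  simp only [ENNReal.toReal_ofNat, ENNReal.rpow_ofNat]
  exact this.trans_lt ENNReal.ofReal_lt_top

theorem variance_toReal_apply_le {μ : Measure Ω} [IsFiniteMeasure μ] {R : ℝ≥0}
    (hR : μ Set.univ ≤ R) {A : Set Ω} (hA : MeasurableSet A) :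
    Var[fun κ : Measure Ω => (κ A).toReal; poissonLaw μ] ≤ Real.exp (4 * R) := by
  refine (variance_le_expectation_sq
    (measurable_toReal_apply hA).aestronglyMeasurable).trans ?_
  change ∫ κ : Measure Ω, (κ A).toReal ^ 2 ∂poissonLaw μ ≤ _
  rw [integral_eq_lintegral_of_nonneg_ae (ae_of_all _ fun κ => sq_nonneg _)
    ((measurable_toReal_apply hA).pow_const 2).aestronglyMeasurable]
  refine ENNReal.toReal_le_of_le_ofReal (Real.exp_pos _).le ?_
  refine le_trans (le_of_eq (lintegral_congr fun κ => ?_)) (lintegral_enorm_sq_le hR A)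
  rw [Real.enorm_eq_ofReal ENNReal.toReal_nonneg, ENNReal.ofReal_pow ENNReal.toReal_nonneg]

theorem integral_toReal_apply (μ : Measure Ω) [IsFiniteMeasure μ] {A : Set Ω}
    (hA : MeasurableSet A) : ∫ κ, (κ A).toReal ∂(poissonLaw μ) = μ.real A := by
  have hfin : ∫⁻ κ, κ A ∂(poissonLaw μ) ≠ ∞ := by
    rw [lintegral_poissonLaw_apply μ hA]; exact measure_ne_top _ _
  rw [integral_toReal (Measure.measurable_coe hA).aemeasurable
    (ae_lt_top (Measure.measurable_coe hA) hfin), lintegral_poissonLaw_apply μ hA]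
  rfl

/-- The average number of points in `A` of a sample of configurations. -/
noncomputable def empiricalMean (A : Set Ω) {n : ℕ} (κ : Fin n → Measure Ω) : ℝ :=
  (∑ i, (κ i A).toReal) / n

theorem measurable_empiricalMean {A : Set Ω} (hA : MeasurableSet A) (n : ℕ) :
    Measurable (empiricalMean A : (Fin n → Measure Ω) → ℝ) :=
  (Finset.measurable_sum _ fun i _ =>
    (measurable_toReal_apply hA).comp (measurable_pi_apply i)).div_const _

theorem pi_poissonLaw_empiricalMean_le {μ : Measure Ω} [IsFiniteMeasure μ] {R : ℝ≥0}
    (hR : μ Set.univ ≤ R) {A : Set Ω} (hA : MeasurableSet A) {n : ℕ} (hn : 1 ≤ n) {c : ℝ}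
    (hc : 0 < c) :
    (Measure.pi fun _ : Fin n => poissonLaw μ).real {κ | c ≤ |empiricalMean A κ - μ.real A|}
      ≤ Real.exp (4 * R) / c ^ 2 / n := by
  have hn' : (0 : ℝ) < n := by exact_mod_cast hn
  let X : Fin n → Measure Ω → ℝ := fun _ κ => (κ A).toReal
  have hX : ∀ i : Fin n, MemLp (X i) 2 (poissonLaw μ) := fun i => memLp_two_toReal_apply μ hA
  have hXi : ∀ i : Fin n, MemLp (fun κ : Fin n → Measure Ω => X i (κ i)) 2
      (Measure.pi fun _ : Fin n => poissonLaw μ) := fun i =>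
    (hX i).comp_measurePreserving (measurePreserving_eval (fun _ : Fin n => poissonLaw μ) i)
  have hvar := variance_sum_pi (μ := fun _ : Fin n => poissonLaw μ) hX
  have hmean : ∫ κ, (∑ i, fun κ : Fin n → Measure Ω => X i (κ i)) κ
      ∂(Measure.pi fun _ : Fin n => poissonLaw μ) = n * μ.real A := by
    simp only [Finset.sum_apply]
    rw [integral_finsetSum _ fun i _ => (hXi i).integrable (by norm_num)]
    have : ∀ i : Fin n, ∫ κ, X i (κ i) ∂(Measure.pi fun _ : Fin n => poissonLaw μ)
        = μ.real A := fun i => by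
      rw [integral_comp_eval (μ := fun _ : Fin n => poissonLaw μ) (hX i).aestronglyMeasurable]
      exact integral_toReal_apply μ hA
    simp [this]
  have hcheb := meas_ge_le_variance_div_sq (memLp_finsetSum' Finset.univ fun i _ => hXi i)
    (c := n * c) (by positivity)
  rw [hmean, hvar] at hcheb
  have hset : {κ : Fin n → Measure Ω | c ≤ |empiricalMean A κ - μ.real A|}
      = {κ | n * c ≤ |(∑ i, fun κ : Fin n → Measure Ω => X i (κ i)) κ - n * μ.real A|} := by
    ext κ
    simp only [Set.mem_ofPred_eq, Finset.sum_apply, empiricalMean, X]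
    rw [show (∑ i, (κ i A).toReal) / n - μ.real A
      = ((∑ i, (κ i A).toReal) - n * μ.real A) / n by field_simp, abs_div, abs_of_pos hn',
      le_div_iff₀ hn', mul_comm]
  rw [hset]
  refine (ENNReal.toReal_mono ENNReal.ofReal_ne_top hcheb).trans ?_
  rw [ENNReal.toReal_ofReal
    (div_nonneg (Finset.sum_nonneg fun _ _ => variance_nonneg _ _) (sq_nonneg _))]
  have hsum : ∑ i : Fin n, Var[X i; poissonLaw μ] ≤ n * Real.exp (4 * R) := by
    refine (Finset.sum_le_sum fun i _ => variance_toReal_apply_le hR hA).trans ?_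
    simp
  calc _ ≤ n * Real.exp (4 * R) / (n * c) ^ 2 := by gcongr
    _ = _ := by field_simp

variable {ν : Measure Ω} [IsFiniteMeasure ν]

/-- The test accepting the hypothesis if the empirical means of the sets in `F` are all close to
the corresponding integrals of one and the same intensity in `Θ₀`. -/
noncomputable def proximityTest (Θ₀ : Set (Lp ℝ 2 ν)) (F : Finset {A : Set Ω // MeasurableSet A})
    (c : ℝ) (n : ℕ) : Test Ω n where
  toFun := Set.indicator
    {κ | ∃ f ∈ Θ₀, ∀ A : F, |empiricalMean A.1.1 κ - ∫ t in A.1.1, f t ∂ν| < c}ᶜ fun _ => 1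
  measurable := by
    refine measurable_const.indicator (MeasurableSet.compl ?_)
    have hU : IsOpen {y : F → ℝ | ∃ f ∈ Θ₀, ∀ A : F, |y A - ∫ t in A.1.1, f t ∂ν| < c} := by
      have : {y : F → ℝ | ∃ f ∈ Θ₀, ∀ A : F, |y A - ∫ t in A.1.1, f t ∂ν| < c}
          = ⋃ f ∈ Θ₀, ⋂ A : F, {y : F → ℝ | |y A - ∫ t in A.1.1, f t ∂ν| < c} := by
        ext y; simp
      rw [this]
      exact isOpen_biUnion fun f _ => isOpen_iInter_of_finite fun A =>
        isOpen_lt (by fun_prop) continuous_const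
    have hm : Measurable fun (κ : Fin n → Measure Ω) (A : F) => empiricalMean A.1.1 κ :=
      measurable_pi_lambda _ fun A => measurable_empiricalMean A.1.2 n
    exact hm hU.measurableSet
  nonneg κ := Set.indicator_nonneg (fun _ _ => zero_le_one) κ
  le_one κ := Set.indicator_le_self' (fun _ _ => zero_le_one) κ

theorem sampleLaw_exists_empiricalMean_le {f : Lp ℝ 2 ν} (hf : 0 ≤ᵐ[ν] f) {R : ℝ≥0}
    (hR : meanMeasure f Set.univ ≤ R) (F : Finset {A : Set Ω // MeasurableSet A}) {n : ℕ}
    (hn : 1 ≤ n) {c : ℝ} (hc : 0 < c) :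
    (sampleLaw n f).real {κ | ∃ A ∈ F, c ≤ |empiricalMean A.1 κ - ∫ t in A.1, f t ∂ν|}
      ≤ F.card * (Real.exp (4 * R) / c ^ 2) / n := by
  have hU : {κ : Fin n → Measure Ω | ∃ A ∈ F, c ≤ |empiricalMean A.1 κ - ∫ t in A.1, f t ∂ν|}
      = ⋃ A ∈ F, {κ | c ≤ |empiricalMean A.1 κ - ∫ t in A.1, f t ∂ν|} := by
    ext κ; simp
  rw [hU]
  refine (measureReal_biUnion_finset_le _ _).trans ?_
  refine (Finset.sum_le_sum fun A _ =>
    (?_ : _ ≤ Real.exp (4 * R) / c ^ 2 / n)).trans (le_of_eq ?_)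
  · rw [← meanMeasure_real_apply hf A.2]
    exact pi_poissonLaw_empiricalMean_le hR A.2 hn hc
  · rw [Finset.sum_const, nsmul_eq_mul, mul_div_assoc]

theorem integral_indicator_one_le {X : Type*} [MeasurableSpace X] {P : Measure X}
    [IsProbabilityMeasure P] {s t : Set X} (hst : s ⊆ t) :
    ∫ x, s.indicator (fun _ => (1 : ℝ)) x ∂P ≤ P.real t := by
  by_cases hs : AEStronglyMeasurable (s.indicator fun _ => (1 : ℝ)) P
  · rw [integral_eq_lintegral_of_nonneg_ae
      (ae_of_all _ fun x => Set.indicator_nonneg (fun _ _ => zero_le_one) x) hs]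
    refine ENNReal.toReal_mono (measure_ne_top _ _) ?_
    have : ∀ x, ENNReal.ofReal (s.indicator (fun _ => (1 : ℝ)) x) = s.indicator 1 x := fun x => by
      by_cases hx : x ∈ s <;> simp [hx]
    simp only [this]
    exact (lintegral_indicator_one_le s).trans (measure_mono hst)
  · rw [integral_non_aestronglyMeasurable hs]
    exact measureReal_nonneg

theorem SetwiseSeparated.distinguishable {Θ₀ Θ₁ : Set (Lp ℝ 2 ν)} (h : SetwiseSeparated Θ₀ Θ₁)
    (hpos₀ : ∀ f ∈ Θ₀, 0 ≤ᵐ[ν] f) (hpos₁ : ∀ f ∈ Θ₁, 0 ≤ᵐ[ν] f)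
    (hbdd₀ : Bornology.IsBounded Θ₀) (hbdd₁ : Bornology.IsBounded Θ₁) :
    Distinguishable Θ₀ Θ₁ := by
  obtain ⟨F, δ, hδ, hF⟩ := h
  obtain ⟨R, hR⟩ := (hbdd₀.union hbdd₁).exists_norm_le
  obtain ⟨S, hS⟩ := (uniformlyAC_meanMeasure (u := fun f : ↥(Θ₀ ∪ Θ₁) => (f : Lp ℝ 2 ν))
    fun f => hR _ f.2).exists_measure_univ_le
  have hδ' : 0 < δ / 2 := by positivity
  set B : ℝ := F.card * (Real.exp (4 * S) / (δ / 2) ^ 2) with hB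
  have hB0 : 0 ≤ B := by positivity
  have hI : ∀ n : ℕ, 1 ≤ n → typeIError Θ₀ (proximityTest Θ₀ F (δ / 2) n) ≤ B / n := by
    intro n hn
    refine Real.iSup_le (fun f => ?_) (by positivity)
    refine (integral_indicator_one_le fun κ hκ => ?_).trans
      (sampleLaw_exists_empiricalMean_le (hpos₀ _ f.2) (hS ⟨f, Or.inl f.2⟩) F hn hδ')
    by_contra hc
    simp only [Set.mem_ofPred_eq, not_exists, not_and, not_le] at hc
    exact hκ ⟨f, f.2, fun A => hc A.1 A.2⟩
  have hII : ∀ n : ℕ, 1 ≤ n → typeIIError Θ₁ (proximityTest Θ₀ F (δ / 2) n) ≤ B / n := by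
    intro n hn
    refine Real.iSup_le (fun g => ?_) (by positivity)
    have hcompl : ∀ κ, 1 - (proximityTest Θ₀ F (δ / 2) n).toFun κ = Set.indicator
        {κ | ∃ f ∈ Θ₀, ∀ A : F, |empiricalMean A.1.1 κ - ∫ t in A.1.1, f t ∂ν| < δ / 2}
          (fun _ => 1) κ := by
      intro κ
      rw [sub_eq_iff_eq_add]
      exact (congrFun (Set.indicator_self_add_compl _ (fun _ => (1 : ℝ))) κ).symm
    simp only [hcompl]
    refine (integral_indicator_one_le ?_).trans
      (sampleLaw_exists_empiricalMean_le (hpos₁ _ g.2) (hS ⟨g, Or.inr g.2⟩) F hn hδ')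
    rintro κ ⟨f, hf, hfκ⟩
    obtain ⟨A, hA, hle⟩ := hF f hf g g.2
    refine ⟨A, hA, ?_⟩
    have h₁ := hfκ ⟨A, hA⟩
    have h₂ := abs_sub_le (∫ t in A.1, f t ∂ν) (empiricalMean A.1 κ)
      (∫ t in A.1, (g : Lp ℝ 2 ν) t ∂ν)
    rw [abs_sub_comm] at h₁
    linarith
  have hlim : Tendsto (fun n : ℕ => B / n) atTop (𝓝 0) :=
    tendsto_const_div_atTop_nhds_zero_nat B
  intro a ha _
  obtain ⟨N, hN⟩ := eventually_atTop.1 (hlim.eventually (gt_mem_nhds ha))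
  let acceptAll : (n : ℕ) → Test Ω n := fun n =>
    ⟨fun _ => 0, measurable_const, fun _ => le_rfl, fun _ => zero_le_one⟩
  refine ⟨fun n => if N ≤ n then proximityTest Θ₀ F (δ / 2) n else acceptAll n,
    fun n hn => ?_, ?_⟩
  · by_cases hNn : N ≤ n
    · simp only [hNn, if_true]
      exact (hI n hn).trans_lt (hN n hNn)
    · simp only [hNn, if_false]
      refine lt_of_le_of_lt (Real.iSup_le (fun f => ?_) le_rfl) ha
      simp [acceptAll]
  · refine tendsto_of_tendsto_of_tendsto_of_le_of_le' tendsto_const_nhds hlim ?_ ?_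
    · refine Eventually.of_forall fun n => Real.iSup_nonneg fun g => ?_
      exact integral_nonneg fun κ => sub_nonneg.2 (Test.le_one _ κ)
    · filter_upwards [eventually_ge_atTop N, eventually_ge_atTop 1] with n hNn hn
      simp only [hNn, if_true]
      exact hII n hn

end Consistency

theorem Indistinguishable.not_distinguishable {Ω : Type*} [MeasurableSpace Ω] {ν : Measure Ω}
    {Θ₀ Θ₁ : Set (Lp ℝ 2 ν)} (h : Indistinguishable Θ₀ Θ₁) : ¬ Distinguishable Θ₀ Θ₁ := by
  intro hd
  obtain ⟨K, hI, hII⟩ := hd (1 / 2) (by norm_num) (by norm_num)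
  obtain ⟨n, hn, hn1⟩ := ((hII.eventually (gt_mem_nhds (show (0 : ℝ) < 1 / 2 by norm_num))).and
    (eventually_ge_atTop 1)).exists
  linarith [h n hn1 (K n), hI n hn1]

end PoissonTesting

theorem theorem2p11 {Ω : Type*} [TopologicalSpace Ω] [T2Space Ω] [MeasurableSpace Ω] [BorelSpace Ω]
    (ν : Measure Ω) [IsFiniteMeasure ν]
    (Θ : Submodule ℝ (Lp ℝ 2 ν)) (hΘ : IsClosed (Θ : Set (Lp ℝ 2 ν)))
    (hone : (memLp_const (1 : ℝ) : MemLp (fun _ : Ω => (1 : ℝ)) 2 ν).toLp _ ∈ Θ)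
    (Θ₀ Θ₁ : Set (Lp ℝ 2 ν))
    (hΘ₀ : Θ₀ ⊆ Θ) (hΘ₁ : Θ₁ ⊆ Θ)
    (hpos₀ : ∀ f ∈ Θ₀, 0 ≤ᵐ[ν] f) (hpos₁ : ∀ f ∈ Θ₁, 0 ≤ᵐ[ν] f)
    (hbdd₀ : Bornology.IsBounded Θ₀) (hbdd₁ : Bornology.IsBounded Θ₁) :
    (PoissonTesting.Distinguishable Θ₀ Θ₁ ↔ PoissonTesting.FiniteDimSeparated Θ Θ₀ Θ₁) ∧
      (¬ PoissonTesting.FiniteDimSeparated Θ Θ₀ Θ₁ → PoissonTesting.Indistinguishable Θ₀ Θ₁) := by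
  have hsep : PoissonTesting.FiniteDimSeparated Θ Θ₀ Θ₁
      ↔ PoissonTesting.SetwiseSeparated Θ₀ Θ₁ :=
    ⟨fun h => h.setwiseSeparated hbdd₀ hbdd₁, fun h => h.finiteDimSeparated hΘ hΘ₀ hΘ₁⟩
  have hind : ¬ PoissonTesting.FiniteDimSeparated Θ Θ₀ Θ₁ →
      PoissonTesting.Indistinguishable Θ₀ Θ₁ := fun h =>
    PoissonTesting.indistinguishable_of_not_setwiseSeparated hpos₀ hpos₁ hbdd₀ hbdd₁
      (mt hsep.2 h)
  refine ⟨⟨fun hd => ?_, fun h => ?_⟩, hind⟩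
  · by_contra h
    exact (hind h).not_distinguishable hd
  · exact (hsep.1 h).distinguishable hpos₀ hpos₁ hbdd₀ hbdd₁
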